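/- For $\eta>0$ and $0<\phi<\pi/2$ let $\Delta(\phi,\eta)=\{z\in\mathbb C: |z|<1+\eta,\ |\mathrm{Arg}(z-1)|>\phi\}$ (so $1\notin\Delta(\phi,\eta)$, and $\Delta(\phi,\eta)$ contains the open unit disc). A function defined by a Taylor series at $0$ with radius of convergence equal to $1$ is called $\Delta$-regular in $\Delta(\phi,\eta)$ if it continues analytically to $\Delta(\phi,\eta)$; the continuation is denoted by the same letter. The Hadamard product of $f(z)=\sum_{n\ge0} f_nz^n$ and $g(z)=\sum_{n\ge0} g_nz^n$ is $(f\odot g)(z)=\sum_{n\ge0} f_ng_nz^n$. Proposition. Let $0<\psi_0<\pi/2$, $\eta>0$, and let $a,b$ be real numbers with $a+b+1<0$. Suppose that $f$ and $g$ are $\Delta$-regular in $\Delta(\psi_0,\eta)$ and that $$f(z)=O(|1-z|^a)\quad\text{and}\quad g(z)=O(|1-z|^b)\qquad\text{uniformly for } z\in\Delta(\psi_0,\eta).$$ Then there are $\psi_1\in[\psi_0,\pi/2)$ and $\eta_1\in(0,\eta]$ such that $f\odot g$ continues analytically to the (possibly smaller) domain $\Delta'=\Delta(\psi_1,\eta_1)$,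 and the continuation satisfies $$(f\odot g)(z)=O(|1-z|^{a+b+1})\qquad\text{uniformly for } z\in\Delta'.$$ -/

import Mathlib

open Asymptotics Filter

/-- The domain `Δ(φ, η) = {z : |z| < 1 + η, |Arg (z - 1)| > φ}`. The point `z = 1` is excluded
for every `φ ≥ 0`, because `Complex.arg 0 = 0`. -/
def deltaDomain (φ η : ℝ) : Set ℂ :=
  {z : ℂ | ‖z‖ < 1 + η ∧ φ < |Complex.arg (z - 1)|}

/-- The power series `∑ pₙ zⁿ` as a formal multilinear series on `ℂ`. -/
noncomputable def toFormal (p : PowerSeries ℂ) : FormalMultilinearSeries ℂ ℂ ℂ :=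
  FormalMultilinearSeries.ofScalars ℂ (fun n => PowerSeries.coeff n p)

/-- The Hadamard (termwise) product `∑ aₙ bₙ zⁿ` of `∑ aₙ zⁿ` and `∑ bₙ zⁿ`. -/
noncomputable def hadamardProduct (p q : PowerSeries ℂ) : PowerSeries ℂ :=
  PowerSeries.mk fun n => PowerSeries.coeff n p * PowerSeries.coeff n q

/-- `F` is the analytic continuation to `Δ(φ, η)` of the function defined near `0` by the
convergent power series `p`. -/
structure IsDeltaContinuation (p : PowerSeries ℂ) (F : ℂ → ℂ) (φ η : ℝ) : Prop where
  taylor : HasFPowerSeriesAt F (toFormal p) 0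
  analytic : AnalyticOnNhd ℂ F (deltaDomain φ η)

/-- The function defined by the Taylor series `p` is `Δ`-regular in `Δ(φ, η)`, with analytic
continuation `F`: the radius of convergence of `p` is `1`, and `F` continues it to `Δ(φ, η)`. -/
structure IsDeltaRegular (p : PowerSeries ℂ) (F : ℂ → ℂ) (φ η : ℝ) : Prop
    extends IsDeltaContinuation p F φ η where
  radius_eq_one : (toFormal p).radius = 1

/-! The Hadamard product is the convolution `(2πi)⁻¹ ∮ F(w) G(z/w) dw/w`. In the coordinate `log w`
a logarithmic spiral is straight, and `|arg|` satisfies the triangle inequality; hence if `z` lies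
in `spiralDomain κ ρ` and `w` on its bounding spirals, `z/w` lies in `spiralDomain κ 1`
(`div_real_mul_exp_mem_spiralDomain`), while `w` does too when `ρ < 1`. One contour thus serves all
of `spiralDomain κ ρ`. By Cauchy's formula the integral has Taylor coefficients `fₙ gₙ`, so the
functions obtained for different `ρ` agree and glue to a continuation on `spiralDomain κ 1`
(`exists_spiralHadamard_continuation`). Spiral domains and Δ-domains can be nested in each other at
`1`, up to a change of angle and radius.

For the bound, take `z` in the narrower `spiralDomain (κ/2) 1`, put `r = ‖1 - z‖` and let `1 - ρ` be
a small multiple of `r`. At parameter `α` of the contour both `‖1 - w‖` and `‖1 - z/w‖` are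
comparable to `r + α` (`spiral_arc_comparable`), so the integral is at most a constant times `∫ (r +
α)^(a+b) dα`, which is `O(r^(a+b+1))` because `a + b + 1 < 0`. -/

/-! ### Geometry of spiral domains -/

/-- The region `‖z‖ < ρ exp (κ |arg z|)` to the left of a pair of logarithmic spirals
issuing from `ρ`. -/
def spiralDomain (κ ρ : ℝ) : Set ℂ :=
  {z : ℂ | ‖z‖ < ρ * Real.exp (κ * |z.arg|)}

lemma abs_arg_exp_of_abs_im_le {t : ℂ} (ht : |t.im| ≤ Real.pi) :
    |(Complex.exp t).arg| = |t.im| := by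
  have hpi := Real.pi_pos
  rcases eq_or_lt_of_le (abs_le.1 ht).1 with h | h
  · have : Complex.exp t = ((-Real.exp t.re : ℝ) : ℂ) := by
      rw [← Complex.re_add_im t, ← h, Complex.exp_add]
      simp [Complex.exp_neg, Complex.ofReal_exp]
    rw [this, Complex.arg_ofReal_of_neg (by simpa using Real.exp_pos _), ← h, abs_neg]
  · rw [Complex.arg_exp, (toIocMod_eq_self _).2]
    refine ⟨h, ?_⟩
    have := (abs_le.1 ht).2
    linarith

/-- `|arg z|` is the unoriented angle between `1` and `z`, so the triangle inequality for angles
applies and the branch cut plays no role. -/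
lemma abs_arg_le_abs_arg_div_add {z w : ℂ} (hz : z ≠ 0) (hw : w ≠ 0) :
    |z.arg| ≤ |(z / w).arg| + |w.arg| := by
  have h := InnerProductGeometry.angle_le_angle_add_angle (1 : ℂ) w z
  rw [Complex.angle_one_left hz, Complex.angle_one_left hw, InnerProductGeometry.angle_comm w z,
    Complex.angle_eq_abs_arg hz hw] at h
  linarith

lemma abs_arg_sub_abs_arg_le {z w : ℂ} (hz : z ≠ 0) (hw : w ≠ 0) :
    abs (|z.arg| - |w.arg|) ≤ |(z / w).arg| := by
  have h := abs_arg_le_abs_arg_div_add hz hw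
  have h' := abs_arg_le_abs_arg_div_add hw hz
  rw [← inv_div, Complex.abs_arg_inv] at h'
  rw [abs_le]
  constructor <;> linarith

/-- Although `arg` jumps across the negative axis, `|arg|` is an angle with `1` and is continuous
away from `0`; near `0` the disc of radius `ρ` suffices. -/
lemma isOpen_spiralDomain {κ ρ : ℝ} (hκ : 0 ≤ κ) (hρ : 0 < ρ) : IsOpen (spiralDomain κ ρ) := by
  rw [isOpen_iff_mem_nhds]
  intro z hz
  by_cases h0 : z = 0
  · subst h0
    filter_upwards [Metric.ball_mem_nhds (0 : ℂ) hρ] with w hw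
    have h1 : 1 ≤ Real.exp (κ * |w.arg|) := Real.one_le_exp (by positivity)
    have h2 : ‖w‖ < ρ := by simpa using hw
    show ‖w‖ < _
    nlinarith
  · have hc : ContinuousAt (fun w : ℂ => InnerProductGeometry.angle (1 : ℂ) w) z :=
      (InnerProductGeometry.continuousAt_angle (x := ((1 : ℂ), z)) one_ne_zero h0).comp
        (f := fun w : ℂ => ((1 : ℂ), w)) (by fun_prop)
    have hz' : ‖z‖ < ρ * Real.exp (κ * InnerProductGeometry.angle (1 : ℂ) z) := by
      rw [Complex.angle_one_left h0]; exact hz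
    have hc' : ContinuousAt
        (fun w : ℂ => ρ * Real.exp (κ * InnerProductGeometry.angle (1 : ℂ) w)) z := by
      fun_prop
    filter_upwards [continuous_norm.continuousAt.eventually_lt hc' hz',
      isOpen_ne.mem_nhds h0] with w hw hw0
    rwa [Complex.angle_one_left hw0] at hw

lemma zero_mem_spiralDomain {κ ρ : ℝ} (hρ : 0 < ρ) : (0 : ℂ) ∈ spiralDomain κ ρ := by
  simpa [spiralDomain] using hρ

lemma mem_spiralDomain_of_norm_lt {κ ρ : ℝ} {z : ℂ} (hκ : 0 ≤ κ) (hρ : 0 < ρ) (hz : ‖z‖ < ρ) :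
    z ∈ spiralDomain κ ρ := by
  have h1 : 1 ≤ Real.exp (κ * |z.arg|) := Real.one_le_exp (by positivity)
  show ‖z‖ < _
  nlinarith

lemma spiralDomain_mono {κ ρ ρ' : ℝ} (h : ρ ≤ ρ') : spiralDomain κ ρ ⊆ spiralDomain κ ρ' := by
  intro z hz
  refine lt_of_lt_of_le (show ‖z‖ < _ from hz) ?_
  gcongr

lemma isPreconnected_spiralDomain {κ ρ : ℝ} (hρ : 0 < ρ) :
    IsPreconnected (spiralDomain κ ρ) := by
  have h : StarConvex ℝ (0 : ℂ) (spiralDomain κ ρ) := by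
    rw [starConvex_zero_iff]
    intro z hz t ht0 ht1
    rcases ht0.eq_or_lt with rfl | ht0
    · simpa using zero_mem_spiralDomain hρ
    · show ‖t • z‖ < ρ * Real.exp (κ * |(t • z).arg|)
      rw [Complex.real_smul, Complex.arg_real_mul _ ht0, norm_mul, Complex.norm_real,
        Real.norm_of_nonneg ht0.le]
      refine lt_of_le_of_lt ?_ hz
      nlinarith [norm_nonneg z]
  exact (h.isPathConnected (zero_mem_spiralDomain hρ)).isConnected.isPreconnected

/-- Points of the spirals, dilated by `ρ < 1`, lie in the spiral domain. -/
lemma real_mul_exp_mem_spiralDomain {κ ρ : ℝ} (hρ : 0 < ρ) (hρ1 : ρ < 1) {t : ℂ}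
    (ht : |t.im| ≤ Real.pi) (ht' : t.re ≤ κ * |t.im|) :
    (ρ : ℂ) * Complex.exp t ∈ spiralDomain κ 1 := by
  show ‖(ρ : ℂ) * Complex.exp t‖ < 1 * Real.exp (κ * |((ρ : ℂ) * Complex.exp t).arg|)
  rw [Complex.arg_real_mul _ hρ, abs_arg_exp_of_abs_im_le ht, norm_mul, Complex.norm_real,
    Real.norm_of_nonneg hρ.le, Complex.norm_exp]
  have h1 : Real.exp t.re ≤ Real.exp (κ * |t.im|) := Real.exp_le_exp.2 ht'
  nlinarith [Real.exp_pos t.re]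

/-- With `w = ρ exp t`, `log ‖z/w‖ < κ|arg z| - κ|arg w| ≤ κ|arg (z/w)|`. -/
lemma div_real_mul_exp_mem_spiralDomain {κ ρ : ℝ} (hκ : 0 ≤ κ) (hρ : 0 < ρ) {z t : ℂ}
    (hz : z ∈ spiralDomain κ ρ) (ht : |t.im| ≤ Real.pi) (ht' : κ * |t.im| ≤ t.re) :
    z / ((ρ : ℂ) * Complex.exp t) ∈ spiralDomain κ 1 := by
  have hρ' : (ρ : ℂ) ≠ 0 := by exact_mod_cast hρ.ne'
  by_cases h0 : z = 0
  · simpa [h0] using zero_mem_spiralDomain one_pos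
  have ha := abs_arg_le_abs_arg_div_add h0 (mul_ne_zero hρ' (Complex.exp_ne_zero t))
  rw [Complex.arg_real_mul _ hρ, abs_arg_exp_of_abs_im_le ht] at ha
  show ‖z / ((ρ : ℂ) * Complex.exp t)‖ < 1 * Real.exp _
  rw [norm_div, norm_mul, Complex.norm_real, Real.norm_of_nonneg hρ.le, Complex.norm_exp,
    div_lt_iff₀ (by positivity)]
  refine lt_of_lt_of_le (show ‖z‖ < _ from hz) ?_
  rw [one_mul, mul_left_comm, ← Real.exp_add]
  gcongr
  nlinarith

/-! ### Comparison of spiral domains with Δ-domains -/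

lemma exists_spiralDomain_subset_deltaDomain {ψ η : ℝ} (hψ : 0 < ψ) (hψ' : ψ < Real.pi / 2)
    (hη : 0 < η) :
    ∃ κ : ℝ, 0 < κ ∧ κ ≤ 1 / 5 ∧ spiralDomain κ 1 ⊆ deltaDomain ψ η := by
  have hpi := Real.pi_pos
  have hT : 0 < Real.tan ψ := Real.tan_pos_of_pos_of_lt_pi_div_two hψ hψ'
  have hlog : 0 < Real.log (1 + η) := Real.log_pos (by linarith)
  -- `κπ ≤ log (1 + η)` controls the modulus and `κ tan ψ ≤ 1` keeps the spirals outside the sector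
  -- at `1`; `1/5` serves the numerical estimates near `1`.
  refine ⟨min (1 / 5) (min (Real.log (1 + η) / Real.pi) (1 / Real.tan ψ)), by positivity,
    min_le_left _ _, ?_⟩
  set κ := min (1 / 5) (min (Real.log (1 + η) / Real.pi) (1 / Real.tan ψ)) with hκdef
  have hκ : 0 < κ := by positivity
  have hκ1 : κ * Real.pi ≤ Real.log (1 + η) := by
    rw [← le_div_iff₀ hpi]
    exact (min_le_right _ _).trans (min_le_left _ _)
  have hκ2 : κ * Real.tan ψ ≤ 1 := by
    rw [← le_div_iff₀ hT]
    exact (min_le_right _ _).trans (min_le_right _ _)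
  intro z hz
  have hz' : ‖z‖ < Real.exp (κ * |z.arg|) := by simpa [spiralDomain] using hz
  refine ⟨?_, ?_⟩
  · refine hz'.trans_le ?_
    rw [← Real.le_log_iff_exp_le (by linarith)]
    exact (mul_le_mul_of_nonneg_left (Complex.abs_arg_le_pi z) hκ.le).trans hκ1
  -- In the sector, with `p = re (z - 1)`, `κ|arg z| ≤ p/(1+p) ≤ log (1+p) ≤ log ‖z‖`, contrary to
  -- membership in the spiral domain.
  · by_contra! hcon
    have hre : 0 ≤ (z - 1).re := Complex.abs_arg_le_pi_div_two_iff.1 (by linarith)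
    set p := (z - 1).re with hp
    have hzre : z.re = 1 + p := by simp [hp]
    have him : |z.im| ≤ Real.tan ψ * p := by
      have h1 : (z - 1).im = z.im := by simp
      have h2 : |(z - 1).im| = ‖z - 1‖ * Real.sin |(z - 1).arg| := by
        conv_lhs => rw [← Complex.norm_mul_sin_arg (z - 1), abs_mul, abs_norm]
        congr 1
        rcases abs_cases (z - 1).arg with ⟨h, h'⟩ | ⟨h, h'⟩
        · rw [h, abs_of_nonneg]
          exact Real.sin_nonneg_of_nonneg_of_le_pi h' (by linarith)
        · rw [h, Real.sin_neg, abs_of_nonpos]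
          exact Real.sin_nonpos_of_nonpos_of_neg_pi_le h'.le (by linarith)
      have h3 : p = ‖z - 1‖ * Real.cos |(z - 1).arg| := by
        rw [Real.cos_abs, Complex.norm_mul_cos_arg]
      have hc0 : 0 < Real.cos ψ := Real.cos_pos_of_mem_Ioo ⟨by linarith, hψ'⟩
      have hs : Real.sin |(z - 1).arg| ≤ Real.sin ψ :=
        Real.sin_le_sin_of_le_of_le_pi_div_two (by linarith [abs_nonneg (z - 1).arg]) hψ'.le hcon
      have hc : Real.cos ψ ≤ Real.cos |(z - 1).arg| :=
        Real.cos_le_cos_of_nonneg_of_le_pi (abs_nonneg _) (by linarith) hcon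
      have hs0 : 0 ≤ Real.sin ψ := (Real.sin_pos_of_pos_of_lt_pi hψ (by linarith)).le
      rw [← h1, h2, h3, Real.tan_eq_sin_div_cos, div_mul_eq_mul_div, le_div_iff₀ hc0]
      have := norm_nonneg (z - 1)
      calc ‖z - 1‖ * Real.sin |(z - 1).arg| * Real.cos ψ
          ≤ ‖z - 1‖ * Real.sin ψ * Real.cos |(z - 1).arg| := by gcongr
        _ = _ := by ring
    have hzpos : 0 < z.re := by linarith
    have harg : |z.arg| ≤ Real.tan ψ * p / (1 + p) := by
      have hlt : |z.arg| < Real.pi / 2 := Complex.abs_arg_lt_pi_div_two_iff.2 (Or.inl hzpos)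
      have h1 : |z.arg| ≤ Real.tan |z.arg| := Real.le_tan (abs_nonneg _) hlt
      have h2 : Real.tan |z.arg| = |z.im| / z.re := by
        have : |Real.tan z.arg| = |z.im| / z.re := by
          rw [Complex.tan_arg, abs_div, abs_of_pos hzpos]
        rw [← this]
        rcases abs_cases z.arg with ⟨h, h'⟩ | ⟨h, h'⟩
        · rw [h, abs_of_nonneg]
          exact Real.tan_nonneg_of_nonneg_of_le_pi_div_two h' (by linarith)
        · rw [h, Real.tan_neg, abs_of_nonpos]
          exact Real.tan_nonpos_of_nonpos_of_neg_pi_div_two_le h'.le (by linarith)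
      rw [h2, hzre] at h1
      refine h1.trans ?_
      gcongr
    have h1 : 1 + p ≤ ‖z‖ := by rw [← hzre]; exact Complex.re_le_norm z
    have h2 : p / (1 + p) ≤ Real.log (1 + p) := by
      have := Real.one_sub_inv_le_log_of_pos (show 0 < 1 + p by linarith)
      refine le_trans (le_of_eq ?_) this
      field_simp
      ring
    have h3 : κ * |z.arg| ≤ Real.log (1 + p) := by
      refine le_trans ?_ h2
      calc κ * |z.arg| ≤ κ * (Real.tan ψ * p / (1 + p)) := by gcongr
        _ = (κ * Real.tan ψ) * (p / (1 + p)) := by ring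
        _ ≤ 1 * (p / (1 + p)) := by gcongr
        _ = _ := one_mul _
    have h4 : Real.exp (κ * |z.arg|) ≤ 1 + p := by
      rwa [← Real.le_log_iff_exp_le (by linarith)]
    linarith

lemma exists_deltaDomain_subset_spiralDomain {κ ψ η : ℝ} (hκ : 0 < κ) (hψ : ψ < Real.pi / 2)
    (hη : 0 < η) :
    ∃ ψ₁ η₁ : ℝ, ψ ≤ ψ₁ ∧ ψ₁ < Real.pi / 2 ∧ 0 < η₁ ∧ η₁ ≤ η ∧ η₁ ≤ 1 ∧
      deltaDomain ψ₁ η₁ ⊆ spiralDomain κ 1 := by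
  have hpi := Real.pi_pos
  -- Outside the spiral domain `κy ≤ x`, where `x = log ‖z‖` and `y = |arg z|`. Then `x ≤ κ²/4`
  -- forces `y² ≤ x/4`, hence `re z - 1 ≥ x/2`; with `|im z| ≤ 2y ≤ 2x/κ` the slope of `z - 1` is at
  -- most `4/κ`.
  refine ⟨max ψ (Real.arctan (4 / κ)), min η (min 1 (κ ^ 2 / 4)), le_max_left _ _,
    max_lt hψ (Real.arctan_lt_pi_div_two _), by positivity, min_le_left _ _,
    (min_le_right _ _).trans (min_le_left _ _), ?_⟩
  set η₁ := min η (min 1 (κ ^ 2 / 4))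
  have hη1 : η₁ ≤ 1 := (min_le_right _ _).trans (min_le_left _ _)
  have hη2 : η₁ ≤ κ ^ 2 / 4 := (min_le_right _ _).trans (min_le_right _ _)
  rintro z ⟨hz1, hz2⟩
  replace hz2 : Real.arctan (4 / κ) < |(z - 1).arg| := (le_max_right _ _).trans_lt hz2
  show ‖z‖ < 1 * Real.exp (κ * |z.arg|)
  rw [one_mul]
  by_contra! hcon
  set y := |z.arg| with hy
  have hy0 : 0 ≤ y := abs_nonneg _
  have hzge : 1 ≤ ‖z‖ := (Real.one_le_exp (by positivity)).trans hcon
  set x := Real.log ‖z‖ with hx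
  have hxz : ‖z‖ = Real.exp x := (Real.exp_log (by linarith)).symm
  have hx0 : 0 ≤ x := Real.log_nonneg hzge
  have hyx : κ * y ≤ x := by
    rw [hxz] at hcon
    exact Real.exp_le_exp.1 hcon
  have hxη : x ≤ η₁ := by
    have := Real.log_le_sub_one_of_pos (show 0 < ‖z‖ by linarith)
    linarith
  have hz2' : ‖z‖ ≤ 2 := by linarith
  have hxz' : 1 + x ≤ ‖z‖ := by
    have := Real.add_one_le_exp x
    linarith
  have him : |z.im| ≤ 2 * y := by
    rw [← Complex.norm_mul_sin_arg z, abs_mul, abs_norm]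
    have : |Real.sin z.arg| ≤ y := Real.abs_sin_le_abs
    gcongr
  have hre : x / 2 ≤ z.re - 1 := by
    have hcos : 1 - y ^ 2 / 2 ≤ Real.cos z.arg := by
      rw [hy, sq_abs]; exact Real.one_sub_sq_div_two_le_cos
    have h1 : ‖z‖ * (1 - y ^ 2 / 2) ≤ z.re := by
      rw [← Complex.norm_mul_cos_arg z]; gcongr
    have h2 : y ^ 2 * κ ^ 2 ≤ x * (κ ^ 2 / 4) := by
      calc y ^ 2 * κ ^ 2 = (κ * y) * (κ * y) := by ring
        _ ≤ x * x := by gcongr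
        _ ≤ x * (κ ^ 2 / 4) := by gcongr; linarith
    have h3 : y ^ 2 ≤ x / 4 := by
      have : 0 < κ ^ 2 := by positivity
      nlinarith
    nlinarith
  by_cases hx00 : x = 0
  · have hy00 : y = 0 := by
      have : κ * y ≤ 0 := by linarith
      nlinarith
    have hz1 : z = 1 := by
      have hn : ‖z‖ = 1 := by rw [hxz, hx00, Real.exp_zero]
      have ha : z.arg = 0 := abs_eq_zero.1 hy00
      have := Complex.norm_mul_exp_arg_mul_I z
      rw [hn, ha] at this
      simpa using this.symm
    rw [hz1] at hz2
    have : 0 < 4 / κ := by positivity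
    simp at hz2
    linarith
  · have hxpos : 0 < x := lt_of_le_of_ne hx0 (Ne.symm hx00)
    have hp : 0 < (z - 1).re := by simp; linarith
    have hlt : |(z - 1).arg| < Real.pi / 2 := Complex.abs_arg_lt_pi_div_two_iff.2 (Or.inl hp)
    have ht : Real.tan |(z - 1).arg| ≤ 4 / κ := by
      have h1 : |Real.tan (z - 1).arg| ≤ 4 / κ := by
        rw [Complex.tan_arg, abs_div, abs_of_pos hp, div_le_div_iff₀ hp hκ]
        simp only [Complex.sub_im, Complex.one_im, sub_zero, Complex.sub_re, Complex.one_re]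
        nlinarith
      rcases abs_cases (z - 1).arg with ⟨h, h'⟩ | ⟨h, h'⟩
      · rw [h]; exact (le_abs_self _).trans h1
      · rw [h, Real.tan_neg]; exact (neg_le_abs _).trans h1
    have : |(z - 1).arg| ≤ Real.arctan (4 / κ) := by
      rw [← Real.arctan_tan (by linarith [abs_nonneg (z - 1).arg]) hlt]
      exact Real.arctan_strictMono.monotone ht
    linarith

/-! ### Cauchy's formula on spiral contours -/

lemma integral_segment_eq_sub {S : Set ℂ} (hS : Convex ℝ S) {f Φ : ℂ → ℂ}
    (hf : ContinuousOn f S) (hΦ : ∀ t ∈ S, HasDerivWithinAt Φ (f t) S t) {p v : ℂ} {L : ℝ}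
    (hL : 0 ≤ L) (hp : p ∈ S) (hq : p + L * v ∈ S) :
    ∫ s in (0 : ℝ)..L, f (p + s * v) * v = Φ (p + L * v) - Φ p := by
  have hmem : ∀ s ∈ Set.Icc 0 L, p + (s : ℂ) * v ∈ S := by
    intro s hs
    rcases hL.eq_or_lt with rfl | hL'
    · have : s = 0 := le_antisymm hs.2 hs.1
      simpa [this] using hp
    · have h := hS.add_smul_sub_mem hp hq
        (t := s / L) ⟨div_nonneg hs.1 hL, div_le_one_of_le₀ hs.2 hL⟩
      convert h using 1
      have : (L : ℂ) ≠ 0 := by exact_mod_cast hL'.ne'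
      simp only [add_sub_cancel_left, Complex.real_smul, Complex.ofReal_div]
      field_simp
  have hmaps : Set.MapsTo (fun s : ℝ => p + (s : ℂ) * v) (Set.Icc 0 L) S := hmem
  have hder : ∀ s ∈ Set.Icc 0 L, HasDerivWithinAt (fun s : ℝ => Φ (p + s * v))
      (f (p + s * v) * v) (Set.Icc 0 L) s := by
    intro s hs
    have h1 : HasDerivWithinAt (fun s : ℝ => p + (s : ℂ) * v) v (Set.Icc 0 L) s := by
      have := ((Complex.ofRealCLM.hasDerivAt (x := s)).mul_const v).const_add p
      simpa using this.hasDerivWithinAt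
    exact (hΦ _ (hmem s hs)).comp s h1 hmaps
  have hcont : ContinuousOn (fun s : ℝ => f (p + s * v) * v) (Set.Icc 0 L) :=
    (hf.comp (by fun_prop) hmaps).mul continuousOn_const
  have := intervalIntegral.integral_eq_sub_of_hasDerivAt_of_le hL
    (fun s hs => (hder s hs).continuousWithinAt)
    (fun s hs => (hder s (Set.Ioo_subset_Icc_self hs)).hasDerivAt (Icc_mem_nhds hs.1 hs.2))
    (hcont.intervalIntegrable_of_Icc hL)
  simpa using this

/-- `(2πi)⁻¹ ∮ Φ(w) dw/w` over the positively oriented closed curve formed by the two arcs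
`w = exp ((κ ± i) α)`, `0 ≤ α ≤ π`. -/
noncomputable def spiralIntegral (κ : ℝ) (Φ : ℂ → ℂ) : ℂ :=
  (2 * Real.pi * Complex.I)⁻¹ *
    ((∫ α in (0 : ℝ)..Real.pi, Φ (Complex.exp (α * (κ + Complex.I))) * (κ + Complex.I)) -
      ∫ α in (0 : ℝ)..Real.pi, Φ (Complex.exp (α * (κ - Complex.I))) * (κ - Complex.I))

/-- In the logarithmic coordinate the arc is one side of a triangle inside a convex set, on which
`f` has a primitive. The sign `σ` treats the upper and lower arcs together. -/
lemma integral_spiral_arc_eq {κ : ℝ} (hκ : 0 ≤ κ) {f : ℂ → ℂ} {σ : ℝ} (hσ : |σ| = 1)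
    (hf : ∀ t : ℂ, |t.im| ≤ Real.pi → 0 ≤ σ * t.im → t.re ≤ κ * |t.im| → DifferentiableAt ℂ f t) :
    (∫ α in (0 : ℝ)..Real.pi, f (α * (κ + σ * Complex.I)) * (κ + σ * Complex.I)) =
      (∫ α in (0 : ℝ)..Real.pi, f (α * (σ * Complex.I)) * (σ * Complex.I)) +
      ∫ x in (0 : ℝ)..(Real.pi * κ), f (Real.pi * (σ * Complex.I) + x) := by
  have hpi := Real.pi_pos
  have hσ2 : σ * σ = 1 := by rw [← abs_mul_abs_self, hσ, one_mul]
  have hσπ : σ * (Real.pi * σ) = Real.pi := by linear_combination Real.pi * hσ2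
  let S : Set ℂ := {t | 0 ≤ σ * t.im} ∩ {t | σ * t.im ≤ Real.pi} ∩ {t | t.re ≤ κ * (σ * t.im)}
  have habs : ∀ t : ℂ, 0 ≤ σ * t.im → |t.im| = σ * t.im := by
    intro t ht
    rw [← abs_of_nonneg ht, abs_mul, hσ, one_mul]
  have hS : Convex ℝ S := by
    intro x hx y hy a b ha hb hab
    obtain ⟨⟨h1, h2⟩, h3⟩ := hx
    obtain ⟨⟨k1, k2⟩, k3⟩ := hy
    simp only [Set.mem_ofPred_eq] at h1 h2 h3 k1 k2 k3
    refine ⟨⟨?_, ?_⟩, ?_⟩ <;> simp only [Set.mem_ofPred_eq, Complex.add_im, Complex.add_re,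
      Complex.real_smul, Complex.re_ofReal_mul, Complex.im_ofReal_mul]
    · nlinarith [mul_nonneg ha h1, mul_nonneg hb k1]
    · nlinarith [mul_le_mul_of_nonneg_left h2 ha, mul_le_mul_of_nonneg_left k2 hb]
    · nlinarith [mul_le_mul_of_nonneg_left h3 ha, mul_le_mul_of_nonneg_left k3 hb]
  have hd : DifferentiableOn ℂ f S := by
    intro t ht
    obtain ⟨⟨h1, h2⟩, h3⟩ := ht
    simp only [Set.mem_ofPred_eq] at h1 h2 h3
    rw [← habs t h1] at h2 h3
    exact (hf t h2 h1 h3).differentiableWithinAt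
  obtain ⟨Φ, hΦ⟩ := hS.exists_forall_hasDerivWithinAt hd
  have m0 : (0 : ℂ) ∈ S := by simp [S, hpi.le]
  have m1 : (0 : ℂ) + (Real.pi : ℝ) * (κ + σ * Complex.I) ∈ S := by
    simp only [S, Set.mem_inter_iff, Set.mem_ofPred_eq]
    simp
    rw [hσπ]
    exact ⟨⟨hpi.le, le_rfl⟩, (mul_comm _ _).le⟩
  have m2 : (0 : ℂ) + (Real.pi : ℝ) * (σ * Complex.I) ∈ S := by
    simp only [S, Set.mem_inter_iff, Set.mem_ofPred_eq]
    simp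
    rw [hσπ]
    exact ⟨⟨hpi.le, le_rfl⟩, by positivity⟩
  have m3 : (0 : ℂ) + (Real.pi : ℝ) * (σ * Complex.I) + ((Real.pi * κ : ℝ) : ℂ) * 1 ∈ S := by
    convert m1 using 1
    push_cast
    ring
  have e1 := integral_segment_eq_sub hS hd.continuousOn hΦ hpi.le m0 m1
  have e2 := integral_segment_eq_sub hS hd.continuousOn hΦ hpi.le m0 m2
  have e3 := integral_segment_eq_sub hS hd.continuousOn hΦ (by positivity) m2 m3
  simp only [zero_add, mul_one] at e1 e2 e3
  rw [e1, e2, e3]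
  have : (Real.pi : ℂ) * (κ + σ * Complex.I) =
      Real.pi * (σ * Complex.I) + ((Real.pi * κ : ℝ) : ℂ) := by
    push_cast
    ring
  rw [this]
  ring

lemma spiralIntegral_eq_integral_circle {κ : ℝ} (hκ : 0 ≤ κ) {Φ : ℂ → ℂ}
    (hΦ : ∀ t : ℂ, |t.im| ≤ Real.pi → t.re ≤ κ * |t.im| → DifferentiableAt ℂ Φ (Complex.exp t)) :
    spiralIntegral κ Φ = (2 * Real.pi * Complex.I)⁻¹ *
      ∫ θ in (0 : ℝ)..(2 * Real.pi), Φ (Complex.exp (θ * Complex.I)) * Complex.I := by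
  have hpi := Real.pi_pos
  have hf : ∀ t : ℂ, |t.im| ≤ Real.pi → t.re ≤ κ * |t.im| →
      DifferentiableAt ℂ (fun t => Φ (Complex.exp t)) t := fun t h1 h2 =>
    (hΦ t h1 h2).comp t Complex.differentiableAt_exp
  have h1 := integral_spiral_arc_eq hκ (σ := 1) (by simp) (fun t h1 _ h2 => hf t h1 h2)
  have h2 := integral_spiral_arc_eq hκ (σ := -1) (by simp) (fun t h1 _ h2 => hf t h1 h2)
  simp only [Complex.ofReal_one, one_mul, Complex.ofReal_neg, neg_mul, ← sub_eq_add_neg] at h1 h2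
  -- The two horizontal sides, at heights `±π`, have the same image under `exp`, so their
  -- contributions cancel.
  have hper : ∀ x : ℝ, Complex.exp ((Real.pi : ℂ) * Complex.I + x) =
      Complex.exp ((Real.pi : ℂ) * -Complex.I + x) := by
    intro x
    rw [Complex.exp_add, Complex.exp_add, mul_neg, Complex.exp_neg, Complex.exp_pi_mul_I]
    norm_num
  have hc : Continuous (fun θ : ℝ => Complex.exp (θ * Complex.I)) := by fun_prop
  have hcΦ : Continuous (fun θ : ℝ => Φ (Complex.exp (θ * Complex.I)) * Complex.I) := by
    refine Continuous.mul ?_ continuous_const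
    rw [continuous_iff_continuousAt]
    intro θ
    have hlog : Complex.exp (Complex.log (Complex.exp (θ * Complex.I))) =
      Complex.exp (θ * Complex.I) := Complex.exp_log (Complex.exp_ne_zero _)
    -- The hypothesis only covers `|im t| ≤ π`, so `θi` is replaced by the principal logarithm of
    -- its exponential.
    have hd := hΦ (Complex.log (Complex.exp (θ * Complex.I)))
      (by rw [Complex.log_im]; exact Complex.abs_arg_le_pi _)
      (by rw [Complex.log_re, Complex.norm_exp_ofReal_mul_I, Real.log_one]; positivity)
    rw [hlog] at hd
    exact ContinuousAt.comp (f := fun θ : ℝ => Complex.exp (θ * Complex.I)) hd.continuousAt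
      hc.continuousAt
  have h3 : ∫ α in (0 : ℝ)..Real.pi, Φ (Complex.exp (α * -Complex.I)) * -Complex.I =
      -∫ θ in Real.pi..(2 * Real.pi), Φ (Complex.exp (θ * Complex.I)) * Complex.I := by
    have := intervalIntegral.integral_comp_sub_left (a := Real.pi) (b := 2 * Real.pi)
      (fun θ : ℝ => Φ (Complex.exp (θ * -Complex.I)) * Complex.I) (2 * Real.pi)
    rw [show 2 * Real.pi - 2 * Real.pi = 0 by ring, show 2 * Real.pi - Real.pi = Real.pi by ring]
      at this
    simp_rw [show ∀ w : ℂ, Φ w * -Complex.I = -(Φ w * Complex.I) from fun w => mul_neg _ _]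
    rw [intervalIntegral.integral_neg, ← this]
    congr 1
    apply intervalIntegral.integral_congr
    intro θ _
    simp only
    congr 2
    rw [show ((2 * Real.pi - θ : ℝ) : ℂ) * -Complex.I =
      θ * Complex.I - 2 * Real.pi * Complex.I by push_cast; ring, Complex.exp_sub,
      Complex.exp_two_pi_mul_I, div_one]
  have h4 := intervalIntegral.integral_add_adjacent_intervals
    (hcΦ.intervalIntegrable (μ := MeasureTheory.volume) 0 Real.pi)
    (hcΦ.intervalIntegrable (μ := MeasureTheory.volume) Real.pi (2 * Real.pi))
  unfold spiralIntegral
  rw [h1, h2, ← h4, h3]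
  simp only [hper]
  congr 1
  ring

lemma toFormal_coeff (p : PowerSeries ℂ) (n : ℕ) :
    (toFormal p).coeff n = PowerSeries.coeff n p := by
  simp [toFormal, FormalMultilinearSeries.coeff_ofScalars]

/-- Cauchy's formula for Taylor coefficients, over a dilated spiral contour. -/
lemma coeff_eq_spiralIntegral {κ ρ : ℝ} (hκ : 0 ≤ κ) (hρ : 0 < ρ) (hρ1 : ρ < 1)
    {f : PowerSeries ℂ} {F : ℂ → ℂ} (hf : HasFPowerSeriesAt F (toFormal f) 0)
    (hF : DifferentiableOn ℂ F (spiralDomain κ 1)) (n : ℕ) :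
    PowerSeries.coeff n f = spiralIntegral κ (fun w => F (ρ * w) * ((ρ * w) ^ n)⁻¹) := by
  have hopen := isOpen_spiralDomain hκ one_pos
  have hρ' : (ρ : ℂ) ≠ 0 := by exact_mod_cast hρ.ne'
  rw [spiralIntegral_eq_integral_circle hκ]
  · let R : NNReal := ⟨ρ, hρ.le⟩
    have hball : DifferentiableOn ℂ F (Metric.closedBall 0 R) := by
      refine hF.mono fun z hz => mem_spiralDomain_of_norm_lt hκ one_pos ?_
      have : ‖z‖ ≤ ρ := mem_closedBall_zero_iff.1 hz
      linarith
    have h1 := hball.hasFPowerSeriesOnBall (R := R) (by exact_mod_cast hρ)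
    have h2 : toFormal f = cauchyPowerSeries F 0 R := hf.eq_formalMultilinearSeries h1.hasFPowerSeriesAt
    rw [← toFormal_coeff, h2, FormalMultilinearSeries.coeff]
    have := cauchyPowerSeries_apply F 0 R n 1
    have h1' : (1 : Fin n → ℂ) = fun _ => 1 := rfl
    rw [h1', this, smul_eq_mul]
    congr 1
    rw [circleIntegral]
    apply intervalIntegral.integral_congr
    intro θ _
    have he := Complex.exp_ne_zero (θ * Complex.I)
    have hR : ((R : ℝ) : ℂ) = ρ := rfl
    simp only [deriv_circleMap, circleMap, hR, smul_eq_mul, zero_add, sub_zero, one_div, inv_pow]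
    field_simp
  · intro t h1 h2
    have hm := real_mul_exp_mem_spiralDomain hρ hρ1 h1 h2
    have hne : ((ρ : ℂ) * Complex.exp t) ^ n ≠ 0 :=
      pow_ne_zero _ (mul_ne_zero hρ' (Complex.exp_ne_zero _))
    have hd : DifferentiableAt ℂ F (ρ * Complex.exp t) :=
      (hF _ hm).differentiableAt (hopen.mem_nhds hm)
    refine DifferentiableAt.mul ?_ ?_
    · exact DifferentiableAt.comp (f := fun w : ℂ => ρ * w) _ hd (by fun_prop)
    · exact DifferentiableAt.inv (by fun_prop) hne

/-! ### The Hadamard product as a spiral integral -/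

lemma differentiableOn_integral_mul_comp {Ω V : Set ℂ} (hΩ : IsOpen Ω) (hV : IsOpen V)
    {G : ℂ → ℂ} (hG : DifferentiableOn ℂ G Ω) {c u : ℝ → ℂ} {L : ℝ} (hL : 0 ≤ L)
    (hc : ContinuousOn c (Set.Icc 0 L)) (hu : ContinuousOn u (Set.Icc 0 L))
    (h : ∀ z ∈ V, ∀ α ∈ Set.Icc 0 L, z * u α ∈ Ω) :
    DifferentiableOn ℂ (fun z => ∫ α in (0 : ℝ)..L, c α * G (z * u α)) V := by
  intro z₀ hz₀
  obtain ⟨R, hR, hRV⟩ := Metric.nhds_basis_closedBall.mem_iff.1 (hV.mem_nhds hz₀)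
  have hG' : ContinuousOn (deriv G) Ω := (hG.deriv hΩ).continuousOn
  have hF : ∀ z ∈ V, ContinuousOn (fun α => c α * G (z * u α)) (Set.Icc 0 L) := fun z hz =>
    hc.mul (hG.continuousOn.comp (continuousOn_const.mul hu) (h z hz))
  have hF' : ∀ z ∈ V, ContinuousOn (fun α => c α * (deriv G (z * u α) * u α)) (Set.Icc 0 L) :=
    fun z hz => hc.mul ((hG'.comp (continuousOn_const.mul hu) (h z hz)).mul hu)
  have hK : ContinuousOn (fun q : ℂ × ℝ => c q.2 * (deriv G (q.1 * u q.2) * u q.2))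
      (Metric.closedBall z₀ R ×ˢ Set.Icc 0 L) := by
    have hm : Set.MapsTo (Prod.snd : ℂ × ℝ → ℝ) (Metric.closedBall z₀ R ×ˢ Set.Icc 0 L)
        (Set.Icc 0 L) := fun q hq => hq.2
    have hc2 := hc.comp continuousOn_snd hm
    have hu2 := hu.comp continuousOn_snd hm
    refine hc2.mul (ContinuousOn.mul ?_ hu2)
    exact hG'.comp (continuousOn_fst.mul hu2) fun q hq => h q.1 (hRV hq.1) q.2 hq.2
  obtain ⟨M, hM⟩ := ((isCompact_closedBall z₀ R).prod isCompact_Icc).exists_bound_of_continuousOn hK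
  have hsub : Set.uIoc 0 L ⊆ Set.Icc 0 L := by
    rw [Set.uIoc_of_le hL]; exact Set.Ioc_subset_Icc_self
  refine (intervalIntegral.hasDerivAt_integral_of_dominated_loc_of_deriv_le
    (F := fun z α => c α * G (z * u α)) (F' := fun z α => c α * (deriv G (z * u α) * u α))
    (bound := fun _ => M)
    (Metric.ball_mem_nhds z₀ hR) ?_ ((hF z₀ hz₀).intervalIntegrable_of_Icc hL) ?_ ?_
    intervalIntegrable_const ?_).2.differentiableAt.differentiableWithinAt
  · filter_upwards [hV.mem_nhds hz₀] with z hz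
    exact ((hF z hz).intervalIntegrable_of_Icc hL).def'.aestronglyMeasurable
  · exact ((hF' z₀ hz₀).intervalIntegrable_of_Icc hL).def'.aestronglyMeasurable
  · exact .of_forall fun α hα z hz => hM (z, α) ⟨Metric.ball_subset_closedBall hz, hsub hα⟩
  · refine .of_forall fun α hα z hz => ?_
    have hm := h z (hRV (Metric.ball_subset_closedBall hz)) α (hsub hα)
    have hd : HasDerivAt G (deriv G (z * u α)) (z * u α) :=
      ((hG _ hm).differentiableAt (hΩ.mem_nhds hm)).hasDerivAt
    have hd2 : HasDerivAt (fun z => z * u α) (u α) z := by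
      simpa using (hasDerivAt_id z).mul_const (u α)
    exact (hd.comp z hd2).const_mul (c α)

lemma hasSum_integral_mul_comp {G : ℂ → ℂ} {a : ℕ → ℂ} {r : ℝ}
    (ha : Summable fun n => ‖a n‖ * r ^ n)
    (hG : ∀ y : ℂ, ‖y‖ ≤ r → HasSum (fun n => a n * y ^ n) (G y))
    {c u : ℝ → ℂ} {L : ℝ} (hL : 0 ≤ L)
    (hc : ContinuousOn c (Set.Icc 0 L)) (hu : ContinuousOn u (Set.Icc 0 L)) {z : ℂ}
    (hz : ∀ α ∈ Set.Icc 0 L, ‖z * u α‖ ≤ r) :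
    HasSum (fun n => a n * z ^ n * ∫ α in (0 : ℝ)..L, c α * u α ^ n)
      (∫ α in (0 : ℝ)..L, c α * G (z * u α)) := by
  obtain ⟨M, hM⟩ := isCompact_Icc.exists_bound_of_continuousOn hc
  have hsub : Set.uIoc 0 L ⊆ Set.Icc 0 L := by
    rw [Set.uIoc_of_le hL]; exact Set.Ioc_subset_Icc_self
  have := intervalIntegral.hasSum_integral_of_dominated_convergence
    (μ := MeasureTheory.volume) (a := 0) (b := L)
    (F := fun n α => a n * z ^ n * (c α * u α ^ n)) (f := fun α => c α * G (z * u α))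
    (fun n _ => M * (‖a n‖ * r ^ n)) ?_ ?_ ?_ ?_ ?_
  · simpa only [intervalIntegral.integral_const_mul] using this
  · intro n
    have : ContinuousOn (fun α => a n * z ^ n * (c α * u α ^ n)) (Set.Icc 0 L) :=
      continuousOn_const.mul (hc.mul (hu.pow n))
    exact (this.intervalIntegrable_of_Icc hL).def'.aestronglyMeasurable
  · refine fun n => .of_forall fun α hα => ?_
    have h1 := hM α (hsub hα)
    have h2 := hz α (hsub hα)
    calc ‖a n * z ^ n * (c α * u α ^ n)‖ = ‖c α‖ * (‖a n‖ * ‖z * u α‖ ^ n) := by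
          simp only [norm_mul, norm_pow, mul_pow]; ring
      _ ≤ M * (‖a n‖ * r ^ n) := by
          have := (norm_nonneg _).trans h1
          gcongr
  · exact .of_forall fun α _ => ha.mul_left M
  · exact intervalIntegrable_const
  · refine .of_forall fun α hα => ?_
    refine Eq.mp (congrArg (fun φ => HasSum φ _) (funext fun n => ?_)) ((hG _ (hz α (hsub hα))).mul_left (c α))
    rw [mul_pow]; ring

/-- The Hadamard product of `F` and `G` at `z`, as the integral of `F(w) G(z/w) dw/w` along the
spiral contour dilated by `ρ`. -/
noncomputable def spiralHadamard (κ ρ : ℝ) (F G : ℂ → ℂ) (z : ℂ) : ℂ :=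
  spiralIntegral κ fun w => F (ρ * w) * G (z / (ρ * w))

section
variable {κ ρ : ℝ} {F : ℂ → ℂ}

lemma continuousOn_spiral_arc (hρ : 0 < ρ) (hρ1 : ρ < 1)
    (hF : ContinuousOn F (spiralDomain κ 1)) {σ : ℝ} (hσ : |σ| = 1) :
    ContinuousOn (fun α : ℝ => F (ρ * Complex.exp (α * (κ + σ * Complex.I))) *
      (κ + σ * Complex.I)) (Set.Icc 0 Real.pi) := by
  refine ContinuousOn.mul (hF.comp (by fun_prop) fun α hα => ?_) continuousOn_const
  apply real_mul_exp_mem_spiralDomain hρ hρ1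
  · simpa [abs_mul, hσ, abs_of_nonneg hα.1] using hα.2
  · simp [abs_mul, hσ, abs_of_nonneg hα.1, mul_comm]

lemma continuous_inv_spiral_arc (hρ : 0 < ρ) (μ : ℂ) :
    Continuous (fun α : ℝ => (ρ * Complex.exp (α * μ))⁻¹) := by
  have hρ' : (ρ : ℂ) ≠ 0 := by exact_mod_cast hρ.ne'
  exact Continuous.inv₀ (by fun_prop) fun α => mul_ne_zero hρ' (Complex.exp_ne_zero _)

/-- Taking `Q v = v ^ n` gives the Taylor coefficients of `F`, and `Q v = G (z * v)` the Hadamard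
integral. -/
lemma spiralIntegral_mul_eq (Q : ℂ → ℂ) :
    spiralIntegral κ (fun w => F (ρ * w) * Q (ρ * w)⁻¹) = (2 * Real.pi * Complex.I)⁻¹ *
      ((∫ α in (0 : ℝ)..Real.pi, F (ρ * Complex.exp (α * (κ + (1 : ℝ) * Complex.I))) *
          (κ + (1 : ℝ) * Complex.I) * Q (ρ * Complex.exp (α * (κ + (1 : ℝ) * Complex.I)))⁻¹) -
        ∫ α in (0 : ℝ)..Real.pi, F (ρ * Complex.exp (α * (κ + (-1 : ℝ) * Complex.I))) *
          (κ + (-1 : ℝ) * Complex.I) *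
            Q (ρ * Complex.exp (α * (κ + (-1 : ℝ) * Complex.I)))⁻¹) := by
  simp only [spiralIntegral, Complex.ofReal_one, Complex.ofReal_neg, one_mul, neg_mul,
    ← sub_eq_add_neg, mul_right_comm]

variable {G : ℂ → ℂ}

lemma spiralHadamard_eq (z : ℂ) :
    spiralHadamard κ ρ F G z = (2 * Real.pi * Complex.I)⁻¹ *
      ((∫ α in (0 : ℝ)..Real.pi, F (ρ * Complex.exp (α * (κ + (1 : ℝ) * Complex.I))) *
          (κ + (1 : ℝ) * Complex.I) *
            G (z * (ρ * Complex.exp (α * (κ + (1 : ℝ) * Complex.I)))⁻¹)) -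
        ∫ α in (0 : ℝ)..Real.pi, F (ρ * Complex.exp (α * (κ + (-1 : ℝ) * Complex.I))) *
          (κ + (-1 : ℝ) * Complex.I) *
            G (z * (ρ * Complex.exp (α * (κ + (-1 : ℝ) * Complex.I)))⁻¹)) := by
  rw [spiralHadamard, ← spiralIntegral_mul_eq (fun v => G (z * v))]
  simp only [div_eq_mul_inv]

lemma differentiableOn_spiralHadamard (hκ : 0 ≤ κ) (hρ : 0 < ρ) (hρ1 : ρ < 1)
    (hF : DifferentiableOn ℂ F (spiralDomain κ 1))
    (hG : DifferentiableOn ℂ G (spiralDomain κ 1)) :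
    DifferentiableOn ℂ (spiralHadamard κ ρ F G) (spiralDomain κ ρ) := by
  have key : ∀ σ : ℝ, |σ| = 1 → DifferentiableOn ℂ (fun z => ∫ α in (0 : ℝ)..Real.pi,
      F (ρ * Complex.exp (α * (κ + σ * Complex.I))) * (κ + σ * Complex.I) *
        G (z * (ρ * Complex.exp (α * (κ + σ * Complex.I)))⁻¹)) (spiralDomain κ ρ) := by
    intro σ hσ
    refine differentiableOn_integral_mul_comp (isOpen_spiralDomain hκ one_pos)
      (isOpen_spiralDomain hκ hρ) hG Real.pi_pos.le
      (continuousOn_spiral_arc hρ hρ1 hF.continuousOn hσ)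
      (continuous_inv_spiral_arc hρ _).continuousOn fun z hz α hα => ?_
    rw [← div_eq_mul_inv]
    apply div_real_mul_exp_mem_spiralDomain hκ hρ hz
    · simpa [abs_mul, hσ, abs_of_nonneg hα.1] using hα.2
    · simp [abs_mul, hσ, abs_of_nonneg hα.1, mul_comm]
  rw [show spiralHadamard κ ρ F G = _ from funext spiralHadamard_eq]
  exact ((key 1 (by simp)).sub (key (-1) (by simp))).const_mul _

/-- The contour stays at distance at least `ρ` from `0`, so for small `z` the series of `G(z/w)` can
be integrated term by term, each term producing a Cauchy coefficient of `F`. -/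
lemma hasFPowerSeriesAt_spiralHadamard (hκ : 0 ≤ κ) (hρ : 0 < ρ) (hρ1 : ρ < 1)
    {f g : PowerSeries ℂ} (hf : HasFPowerSeriesAt F (toFormal f) 0)
    (hg : HasFPowerSeriesAt G (toFormal g) 0) (hF : DifferentiableOn ℂ F (spiralDomain κ 1)) :
    HasFPowerSeriesAt (spiralHadamard κ ρ F G) (toFormal (hadamardProduct f g)) 0 := by
  rw [hasFPowerSeriesAt_iff] at hg ⊢
  simp only [toFormal_coeff, zero_add, smul_eq_mul] at hg ⊢
  obtain ⟨ε, hε, hball⟩ := Metric.eventually_nhds_iff.1 hg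
  have hsum : ∀ y : ℂ, ‖y‖ ≤ ε / 2 →
      HasSum (fun n => PowerSeries.coeff n g * y ^ n) (G y) := by
    intro y hy
    simpa only [mul_comm] using hball (y := y) (by rw [dist_zero_right]; linarith)
  have habs : Summable fun n => ‖PowerSeries.coeff n g‖ * (ε / 2) ^ n := by
    have := (hsum ((ε / 2 : ℝ) : ℂ) (by
      rw [Complex.norm_real, Real.norm_of_nonneg (by positivity)])).summable.norm
    simpa [abs_of_pos hε] using this
  filter_upwards [Metric.ball_mem_nhds (0 : ℂ) (show 0 < ρ * (ε / 2) by positivity)] with z hz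
  rw [mem_ball_zero_iff] at hz
  have key : ∀ σ : ℝ, |σ| = 1 → HasSum (fun n => PowerSeries.coeff n g * z ^ n *
      ∫ α in (0 : ℝ)..Real.pi,
        F (ρ * Complex.exp (α * (κ + σ * Complex.I))) * (κ + σ * Complex.I) *
          (ρ * Complex.exp (α * (κ + σ * Complex.I)))⁻¹ ^ n) (∫ α in (0 : ℝ)..Real.pi,
      F (ρ * Complex.exp (α * (κ + σ * Complex.I))) * (κ + σ * Complex.I) *
        G (z * (ρ * Complex.exp (α * (κ + σ * Complex.I)))⁻¹)) := by
    intro σ hσ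
    refine hasSum_integral_mul_comp habs hsum Real.pi_pos.le
      (continuousOn_spiral_arc hρ hρ1 hF.continuousOn hσ)
      (continuous_inv_spiral_arc hρ _).continuousOn fun α hα => ?_
    rw [← div_eq_mul_inv, norm_div, norm_mul, Complex.norm_real, Real.norm_of_nonneg hρ.le,
      Complex.norm_exp, div_le_iff₀ (by positivity)]
    have h1 : 1 ≤ Real.exp (α * (κ + σ * Complex.I)).re := by
      apply Real.one_le_exp
      simpa using mul_nonneg hα.1 hκ
    nlinarith [mul_le_mul_of_nonneg_left h1 (show 0 ≤ ρ * (ε / 2) by positivity)]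
  rw [spiralHadamard_eq]
  refine Eq.mp (congrArg (fun φ => HasSum φ _) (funext fun n => ?_))
    (((key 1 (by simp)).sub (key (-1) (by simp))).mul_left (2 * Real.pi * Complex.I)⁻¹)
  have hn := coeff_eq_spiralIntegral hκ hρ hρ1 hf hF n
  simp only [← inv_pow] at hn
  rw [spiralIntegral_mul_eq (fun v => v ^ n)] at hn
  rw [hadamardProduct, PowerSeries.coeff_mk, hn]
  ring

lemma exists_spiralHadamard_continuation (hκ : 0 ≤ κ) {f g : PowerSeries ℂ}
    (hf : HasFPowerSeriesAt F (toFormal f) 0) (hg : HasFPowerSeriesAt G (toFormal g) 0)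
    (hF : DifferentiableOn ℂ F (spiralDomain κ 1))
    (hG : DifferentiableOn ℂ G (spiralDomain κ 1)) :
    ∃ H : ℂ → ℂ, AnalyticOnNhd ℂ H (spiralDomain κ 1) ∧
      HasFPowerSeriesAt H (toFormal (hadamardProduct f g)) 0 ∧
      ∀ ρ : ℝ, 0 < ρ → ρ < 1 → Set.EqOn H (spiralHadamard κ ρ F G) (spiralDomain κ ρ) := by
  classical
  have han : ∀ ρ : ℝ, 0 < ρ → ρ < 1 →
      AnalyticOnNhd ℂ (spiralHadamard κ ρ F G) (spiralDomain κ ρ) := fun ρ h h1 =>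
    (differentiableOn_spiralHadamard hκ h h1 hF hG).analyticOnNhd (isOpen_spiralDomain hκ h)
  have hle : ∀ ρ ρ' : ℝ, 0 < ρ → ρ ≤ ρ' → ρ' < 1 →
      Set.EqOn (spiralHadamard κ ρ F G) (spiralHadamard κ ρ' F G) (spiralDomain κ ρ) := by
    intro ρ ρ' h hρρ' h1
    -- Identity theorem: both functions have the Taylor series of the Hadamard product at `0`.
    refine (han ρ h (by linarith)).eqOn_of_preconnected_of_eventuallyEq
      ((han ρ' (by linarith) h1).mono (spiralDomain_mono hρρ'))
      (isPreconnected_spiralDomain h) (zero_mem_spiralDomain h) ?_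
    have k1 := hasFPowerSeriesAt_spiralHadamard hκ h (by linarith) hf hg hF
    have k2 := hasFPowerSeriesAt_spiralHadamard hκ (by linarith) h1 hf hg hF
    rw [hasFPowerSeriesAt_iff'] at k1 k2
    filter_upwards [k1, k2] with z hz hz'
    exact hz.unique hz'
  let H : ℂ → ℂ := fun z =>
    if h : ∃ ρ : ℝ, 0 < ρ ∧ ρ < 1 ∧ z ∈ spiralDomain κ ρ then spiralHadamard κ h.choose F G z else 0
  have hH : ∀ ρ : ℝ, 0 < ρ → ρ < 1 →
      Set.EqOn H (spiralHadamard κ ρ F G) (spiralDomain κ ρ) := by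
    intro ρ h0 h1 z hz
    have hex : ∃ ρ : ℝ, 0 < ρ ∧ ρ < 1 ∧ z ∈ spiralDomain κ ρ := ⟨ρ, h0, h1, hz⟩
    obtain ⟨k0, k1, kz⟩ := hex.choose_spec
    simp only [H, dif_pos hex]
    rcases le_total ρ hex.choose with hle' | hle'
    · exact (hle _ _ h0 hle' k1 hz).symm
    · exact hle _ _ k0 hle' h1 kz
  refine ⟨H, fun z hz => ?_, ?_, hH⟩
  · have hlt : ‖z‖ / Real.exp (κ * |z.arg|) < 1 := by
      rw [div_lt_iff₀ (Real.exp_pos _)]; exact hz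
    obtain ⟨ρ, hρ, hρ1⟩ := exists_between hlt
    have hρ0 : 0 < ρ := lt_of_le_of_lt (by positivity) hρ
    have hzρ : z ∈ spiralDomain κ ρ := by
      rwa [div_lt_iff₀ (Real.exp_pos _)] at hρ
    refine (han ρ hρ0 hρ1 z hzρ).congr ?_
    filter_upwards [(isOpen_spiralDomain hκ hρ0).mem_nhds hzρ] with w hw
    exact (hH ρ hρ0 hρ1 hw).symm
  · refine (hasFPowerSeriesAt_spiralHadamard hκ (ρ := 1 / 2) (by norm_num) (by norm_num) hf hg
      hF).congr ?_
    have hh : (0 : ℝ) < 1 / 2 := by norm_num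
    filter_upwards [(isOpen_spiralDomain hκ hh).mem_nhds (zero_mem_spiralDomain hh)] with w hw
    exact (hH (1 / 2) hh (by norm_num) hw).symm

end

/-! ### Log-polar coordinates near `1` and power estimates -/

lemma abs_log_norm_add_abs_arg_le {u : ℂ} (hu : 1 / 2 ≤ ‖u‖) :
    |Real.log ‖u‖| + |u.arg| ≤ 9 * ‖1 - u‖ := by
  have hu0 : 0 < ‖u‖ := by linarith
  have hne : u ≠ 0 := norm_pos_iff.1 hu0
  have hne' : (‖u‖ : ℂ) ≠ 0 := by exact_mod_cast hu0.ne'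
  have hd : |1 - ‖u‖| ≤ ‖1 - u‖ := by simpa using abs_norm_sub_norm_le (1 : ℂ) u
  have hlog : |Real.log ‖u‖| ≤ 2 * ‖1 - u‖ := by
    have h1 := Real.log_le_sub_one_of_pos hu0
    have h2 := Real.one_sub_inv_le_log_of_pos hu0
    have h3 : ‖u‖⁻¹ - 1 = (1 - ‖u‖) * ‖u‖⁻¹ := by field_simp
    have h4 : ‖u‖⁻¹ ≤ 2 := by rw [inv_le_comm₀ hu0 two_pos]; linarith
    have h5 : (1 - ‖u‖) * ‖u‖⁻¹ ≤ ‖1 - u‖ * 2 := by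
      have := (le_abs_self _).trans hd
      have h6 : 0 < ‖u‖⁻¹ := inv_pos.2 hu0
      calc (1 - ‖u‖) * ‖u‖⁻¹ ≤ ‖1 - u‖ * ‖u‖⁻¹ := by gcongr
        _ ≤ ‖1 - u‖ * 2 := by gcongr
    rw [abs_le]
    constructor
    · linarith
    · linarith [(neg_abs_le _).trans' (neg_le_neg hd), norm_nonneg (1 - u)]
  -- An angle is at most `π/2` times its chord, and the chord is at most `4‖1 - u‖`; `2π < 7`.
  have harg : |u.arg| ≤ 7 * ‖1 - u‖ := by
    have hn : ‖u / ‖u‖‖ = 1 := by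
      rw [norm_div, Complex.norm_real, norm_norm, div_self hu0.ne']
    have h1 := Complex.angle_le_mul_norm_sub (norm_one : ‖(1 : ℂ)‖ = 1) hn
    rw [Complex.angle_one_left (div_ne_zero hne hne')] at h1
    have h2 : (u / ‖u‖).arg = u.arg := by
      rw [div_eq_inv_mul, ← Complex.ofReal_inv, Complex.arg_real_mul _ (inv_pos.2 hu0)]
    have h3 : ‖1 - u / ‖u‖‖ ≤ 4 * ‖1 - u‖ := by
      have h4 : (1 : ℂ) - u / ‖u‖ = (‖u‖ - u) / ‖u‖ := by field_simp
      rw [h4, norm_div, Complex.norm_real, norm_norm, div_le_iff₀ hu0]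
      have h5 : ‖(‖u‖ : ℂ) - u‖ ≤ 2 * ‖1 - u‖ := by
        calc ‖(‖u‖ : ℂ) - u‖ = ‖(1 - u) - ((1 - ‖u‖ : ℝ) : ℂ)‖ := by push_cast; ring_nf
          _ ≤ ‖1 - u‖ + ‖((1 - ‖u‖ : ℝ) : ℂ)‖ := norm_sub_le _ _
          _ ≤ 2 * ‖1 - u‖ := by rw [Complex.norm_real, Real.norm_eq_abs]; linarith
      nlinarith [norm_nonneg (1 - u)]
    rw [h2] at h1
    have := Real.pi_lt_d2
    nlinarith [norm_nonneg (1 - u), Real.pi_pos, norm_nonneg (1 - u / ‖u‖)]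
  linarith

lemma norm_one_sub_le_abs_log_norm_add_abs_arg {u : ℂ} (hne : u ≠ 0) (hu : ‖u‖ ≤ 2) :
    ‖1 - u‖ ≤ 2 * (|Real.log ‖u‖| + |u.arg|) := by
  have hu0 : 0 < ‖u‖ := norm_pos_iff.2 hne
  have h1 : |1 - ‖u‖| ≤ 2 * |Real.log ‖u‖| := by
    have k1 := Real.log_le_sub_one_of_pos hu0
    have k2 := Real.one_sub_inv_le_log_of_pos hu0
    have k3 : 1 - ‖u‖⁻¹ = (‖u‖ - 1) * ‖u‖⁻¹ := by field_simp
    rw [abs_le]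
    constructor
    · rcases le_total ‖u‖ 1 with h | h
      · linarith [abs_nonneg (Real.log ‖u‖)]
      · have k4 : (2 : ℝ)⁻¹ ≤ ‖u‖⁻¹ := by gcongr
        nlinarith [le_abs_self (Real.log ‖u‖)]
    · linarith [neg_abs_le (Real.log ‖u‖), abs_nonneg (Real.log ‖u‖)]
  have h2 : ‖(1 : ℂ) - Complex.exp (u.arg * Complex.I)‖ ≤ |u.arg| := by
    have := Real.norm_exp_I_mul_ofReal_sub_one_le (x := u.arg)
    rwa [mul_comm Complex.I, norm_sub_rev, Real.norm_eq_abs] at this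
  have h3 : (1 : ℂ) - u = ((1 - ‖u‖ : ℝ) : ℂ) +
      ‖u‖ * (1 - Complex.exp (u.arg * Complex.I)) := by
    rw [mul_sub, Complex.norm_mul_exp_arg_mul_I]; push_cast; ring
  calc ‖1 - u‖ ≤ ‖((1 - ‖u‖ : ℝ) : ℂ)‖ + ‖‖u‖ * (1 - Complex.exp (u.arg * Complex.I))‖ := by
        rw [h3]; exact norm_add_le _ _
    _ ≤ 2 * |Real.log ‖u‖| + 2 * |u.arg| := by
        rw [Complex.norm_real, Real.norm_eq_abs, norm_mul, Complex.norm_real, norm_norm]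
        gcongr
    _ = _ := by ring

lemma rpow_le_of_comparable {C s t : ℝ} (hC : 0 < C) (hs : 0 < s) (ht : 0 < t)
    (hst : s ≤ C * t) (hts : t ≤ C * s) (a : ℝ) : t ^ a ≤ C ^ |a| * s ^ a := by
  rcases le_total 0 a with ha | ha
  · rw [abs_of_nonneg ha, ← Real.mul_rpow hC.le hs.le]
    exact Real.rpow_le_rpow ht.le hts ha
  · rw [abs_of_nonpos ha, Real.rpow_neg hC.le, ← Real.inv_rpow hC.le,
      ← Real.mul_rpow (by positivity) hs.le]
    refine Real.rpow_le_rpow_of_nonpos (by positivity) ?_ ha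
    rwa [inv_mul_le_iff₀ hC]

/-- The antiderivative has negative exponent, so its value at the far endpoint can be dropped. -/
lemma integral_add_rpow_le {r p L : ℝ} (hr : 0 < r) (hp : p + 1 < 0) (hL : 0 ≤ L) :
    ∫ α in (0 : ℝ)..L, (r + α) ^ p ≤ (-(p + 1))⁻¹ * r ^ (p + 1) := by
  rw [intervalIntegral.integral_comp_add_left (fun x => x ^ p), add_zero, integral_rpow]
  · have h : 0 ≤ (r + L) ^ (p + 1) := by positivity
    rw [div_eq_inv_mul, inv_neg, neg_mul, ← mul_neg]
    refine mul_le_mul_of_nonpos_left ?_ (inv_nonpos.2 hp.le)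
    linarith
  · refine Or.inr ⟨by linarith, ?_⟩
    rw [Set.uIcc_of_le (by linarith), Set.mem_Icc]
    intro h
    linarith [h.1]

/-! ### The bound near `1` -/

section
variable {κ : ℝ} {z : ℂ}

lemma neg_log_one_sub_bounds {s : ℝ} (hs : 0 < s) (hs' : s ≤ 1 / 2) :
    s ≤ -Real.log (1 - s) ∧ -Real.log (1 - s) ≤ 2 * s := by
  have h : 0 < 1 - s := by linarith
  have h1 := Real.log_le_sub_one_of_pos h
  have h2 := Real.one_sub_inv_le_log_of_pos h
  have h3 : (1 - s)⁻¹ ≤ 1 + 2 * s := by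
    rw [inv_le_iff_one_le_mul₀ h]; nlinarith
  constructor <;> linarith

/-- Halving `κ` leaves room for the dilation. With `e = -log ρ ≤ κr/24` and `r ≤ 2(|x| + y)`, the
loss `e` is absorbed by the spare `κy/2` if `x ≥ 0`, and by `-x` together with `κy` if `x ≤ 0`. -/
lemma mem_spiralDomain_of_half (hκ : 0 < κ) (hκ' : κ ≤ 1 / 5) (hz : z ∈ spiralDomain (κ / 2) 1)
    (hz1 : 0 < ‖1 - z‖) (hz2 : ‖z‖ ≤ 2) :
    z ∈ spiralDomain κ (1 - κ / 48 * ‖1 - z‖) := by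
  set r := ‖1 - z‖ with hr
  have hr3 : r ≤ 3 := (norm_sub_le _ _).trans (by rw [norm_one]; linarith)
  have hδ : 0 < κ / 48 * r := by positivity
  have hδ' : κ / 48 * r ≤ 1 / 2 := by nlinarith
  have hρ : 0 < 1 - κ / 48 * r := by linarith
  rcases lt_or_ge ‖z‖ (1 / 2) with h | h
  · exact mem_spiralDomain_of_norm_lt hκ.le hρ (by linarith)
  have hz0 : 0 < ‖z‖ := by linarith
  obtain ⟨-, he⟩ := neg_log_one_sub_bounds hδ hδ'
  have hup := norm_one_sub_le_abs_log_norm_add_abs_arg (norm_pos_iff.1 hz0) hz2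
  have hx : Real.log ‖z‖ ≤ κ / 2 * |z.arg| := by
    rw [Real.log_le_iff_le_exp hz0]
    simpa [spiralDomain] using (show ‖z‖ < 1 * _ from hz).le
  show ‖z‖ < _
  rw [← Real.log_lt_log_iff hz0 (by positivity), Real.log_mul hρ.ne' (Real.exp_pos _).ne',
    Real.log_exp]
  rw [← hr] at hup
  set x := Real.log ‖z‖
  set y := |z.arg|
  set e := -Real.log (1 - κ / 48 * r)
  have hy : 0 ≤ y := abs_nonneg _
  have he' : e ≤ κ / 24 * r := by linarith
  suffices x + e < κ * y by simp only [e] at this; linarith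
  rcases le_total 0 x with hx0 | hx0
  · rw [abs_of_nonneg hx0] at hup
    have h1 : r ≤ 4 * y := by nlinarith
    have h2 : κ / 24 * r ≤ κ / 24 * (4 * y) := by gcongr
    have hy0 : 0 < y := by linarith
    have := mul_pos hκ hy0
    nlinarith
  · rw [abs_of_nonpos hx0] at hup
    have h2 : κ / 24 * r ≤ κ / 24 * (2 * (-x + y)) := by gcongr
    have h3 : 0 ≤ κ * y := by positivity
    rcases hx0.lt_or_eq with hx1 | hx1
    · have : κ * -x ≤ 1 / 5 * -x := by gcongr; linarith
      nlinarith
    · have hy0 : 0 < y := by linarith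
      have := mul_pos hκ hy0
      nlinarith

/-- Here `D` bounds the log-polar distance between `z` and the contour point. Up to `D`, `κα` is `x
+ e` while `x` is at most `κα/2`, so `κα ≤ 2e + 4D`; the smallness of `e` relative to `κr` then lets
`r` be absorbed. -/
lemma le_of_log_polar_separated {r α e x y D : ℝ} (hκ : 0 < κ) (hκ' : κ ≤ 1 / 5) (hα : 0 ≤ α)
    (he : 0 ≤ e) (her : e ≤ κ / 24 * r) (hx : x ≤ κ / 2 * y)
    (hxD : |x + e - κ * α| ≤ D) (hyD : |y - α| ≤ D) (hr : r ≤ 2 * (|x| + y)) :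
    κ * (r + α) ≤ 40 * D := by
  have hD0 : 0 ≤ D := (abs_nonneg _).trans hyD
  obtain ⟨hx1, hx2⟩ := abs_le.1 hxD
  obtain ⟨hy1, hy2⟩ := abs_le.1 hyD
  have hκα : 0 ≤ κ * α := by positivity
  have hκα' : κ * α ≤ 1 / 5 * α := by gcongr
  have hκD : κ * D ≤ 1 / 5 * D := by gcongr
  have hκe : κ * e ≤ 1 / 5 * e := by gcongr
  have hκy : κ / 2 * y ≤ κ / 2 * (α + D) := by gcongr; linarith
  have hxabs : |x| ≤ κ * α + e + D := by
    rw [abs_le]; constructor <;> linarith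
  have h2 : κ * α ≤ 2 * e + 4 * D := by linarith
  have h3 : κ * r ≤ κ * (4 * α + 2 * e + 4 * D) := by gcongr; linarith
  linarith

/-- Log-polar coordinates of `v` are `(κα - e, ±α)` with `e` of order `κr`, which gives the first
pair of bounds; the lower bound for `z/v` is `le_of_log_polar_separated`. The constant `1000/κ` is a
crude common one. -/
lemma spiral_arc_comparable (hκ : 0 < κ) (hκ' : κ ≤ 1 / 5) (hz : z ∈ spiralDomain (κ / 2) 1)
    (hz1 : 0 < ‖1 - z‖) (hz2 : ‖z‖ ≤ 2) {t : ℂ} {α : ℝ} (hα : α ∈ Set.Icc 0 Real.pi)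
    (ht : t.re = κ * α) (ht' : |t.im| = α) {v : ℂ}
    (hv : v = ((1 - κ / 48 * ‖1 - z‖ : ℝ) : ℂ) * Complex.exp t) :
    (‖1 - z‖ + α ≤ 1000 / κ * ‖1 - v‖ ∧ ‖1 - v‖ ≤ 1000 / κ * (‖1 - z‖ + α)) ∧
      (‖1 - z‖ + α ≤ 1000 / κ * ‖1 - z / v‖ ∧ ‖1 - z / v‖ ≤ 1000 / κ * (‖1 - z‖ + α)) := by
  set r := ‖1 - z‖ with hr
  obtain ⟨hα0, hαpi⟩ := hα
  have hpi := Real.pi_lt_d2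
  have hr3 : r ≤ 3 := (norm_sub_le _ _).trans (by rw [norm_one]; linarith)
  have hδ : 0 < κ / 48 * r := by positivity
  have hδ' : κ / 48 * r ≤ 1 / 2 := by nlinarith
  have hρ : 0 < 1 - κ / 48 * r := by linarith
  obtain ⟨he1, he2⟩ := neg_log_one_sub_bounds hδ hδ'
  set ρ := 1 - κ / 48 * r with hρdef
  set e := -Real.log ρ with hedef
  have hnv : ‖v‖ = ρ * Real.exp (κ * α) := by
    rw [hv, norm_mul, Complex.norm_real, Real.norm_of_nonneg hρ.le, Complex.norm_exp, ht]
  have hargv : |v.arg| = α := by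
    rw [hv, Complex.arg_real_mul _ hρ, abs_arg_exp_of_abs_im_le (ht'.trans_le hαpi), ht']
  have hexp1 : 1 ≤ Real.exp (κ * α) := Real.one_le_exp (by positivity)
  have hκα : κ * α ≤ 1 / 5 * 3.15 := by gcongr; linarith
  have hexp2 : Real.exp (κ * α) ≤ 2 := by
    rw [← Real.le_log_iff_exp_le two_pos]
    have := Real.log_two_gt_d9
    linarith
  have hv1 : 1 / 2 ≤ ‖v‖ := by rw [hnv]; nlinarith
  have hv2 : ‖v‖ ≤ 2 := by rw [hnv]; nlinarith
  have hv0 : 0 < ‖v‖ := by linarith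
  have hvne : v ≠ 0 := norm_pos_iff.1 hv0
  have hlogv : Real.log ‖v‖ = κ * α - e := by
    rw [hnv, Real.log_mul hρ.ne' (Real.exp_pos _).ne', Real.log_exp]; ring
  have hκα' : κ * α ≤ 1 / 5 * α := by gcongr
  have hκα0 : 0 ≤ κ * α := by positivity
  have hκr : κ * r ≤ 1 / 5 * r := by gcongr
  have lowv := abs_log_norm_add_abs_arg_le hv1
  have upv := norm_one_sub_le_abs_log_norm_add_abs_arg hvne hv2
  rw [hlogv, hargv] at lowv upv
  have upv' : ‖1 - v‖ ≤ 4 * (r + α) := by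
    have : |κ * α - e| ≤ κ * α + e := by
      rw [abs_le]; constructor <;> linarith
    linarith
  have hC : 5000 ≤ 1000 / κ := by
    rw [le_div_iff₀ hκ]; linarith
  have hrα : 0 < r + α := by linarith
  refine ⟨⟨?_, ?_⟩, ?_, ?_⟩
  · have h1 : α + κ / 48 * r ≤ 18 * ‖1 - v‖ := by
      have := neg_abs_le (κ * α - e)
      have := abs_nonneg (κ * α - e)
      linarith
    rw [div_mul_eq_mul_div, le_div_iff₀ hκ]
    nlinarith
  · exact upv'.trans (by gcongr; linarith)
  · have hunorm : ‖z / v‖ = ‖z‖ / ‖v‖ := norm_div _ _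
    -- If `z/v` is far from `1`, boundedness of `r + α` is enough.
    rcases lt_or_ge ‖z / v‖ (1 / 2) with h | h
    · have h1 : 1 / 2 ≤ ‖1 - z / v‖ := by
        have := norm_sub_norm_le (1 : ℂ) (z / v)
        rw [norm_one] at this
        linarith
      calc r + α ≤ 5000 * (1 / 2) := by linarith
        _ ≤ 1000 / κ * ‖1 - z / v‖ := by gcongr
    · have hz0 : 0 < ‖z‖ := by
        by_contra! hcon
        have : ‖z‖ = 0 := le_antisymm hcon (norm_nonneg _)
        rw [hunorm, this, zero_div] at h
        linarith
      have hzne : z ≠ 0 := norm_pos_iff.1 hz0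
      have lowu := abs_log_norm_add_abs_arg_le h
      have harg := abs_arg_sub_abs_arg_le hzne hvne
      have hlogu : Real.log ‖z / v‖ = Real.log ‖z‖ + e - κ * α := by
        rw [hunorm, Real.log_div hz0.ne' hv0.ne', hlogv]; ring
      have upz := norm_one_sub_le_abs_log_norm_add_abs_arg hzne hz2
      have hx : Real.log ‖z‖ ≤ κ / 2 * |z.arg| := by
        rw [Real.log_le_iff_le_exp hz0]
        simpa [spiralDomain] using (show ‖z‖ < 1 * _ from hz).le
      rw [hargv] at harg
      rw [hlogu] at lowu
      rw [← hr] at upz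
      set x := Real.log ‖z‖
      set y := |z.arg|
      set D := 9 * ‖1 - z / v‖ with hD
      have := le_of_log_polar_separated hκ hκ' hα0 (hδ.le.trans he1) (by linarith)
        hx (show |x + e - κ * α| ≤ D by linarith [abs_nonneg (z / v).arg])
        (harg.trans (show |(z / v).arg| ≤ D by linarith [abs_nonneg (x + e - κ * α)])) upz
      rw [div_mul_eq_mul_div, le_div_iff₀ hκ]
      linarith [norm_nonneg (1 - z / v)]
  · have h1 : (1 : ℂ) - z / v = ((1 - z) - (1 - v)) / v := by field_simp; ring
    have h2 : ‖1 - z / v‖ ≤ 10 * (r + α) := by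
      rw [h1, norm_div, div_le_iff₀ hv0]
      have := norm_sub_le (1 - z) (1 - v)
      nlinarith
    exact h2.trans (by gcongr; linarith)

/-- The contour varies with `z`. The factor `4` counts two arcs, each with `‖κ ± i‖ ≤ 2`; the
prefactor `(2πi)⁻¹` is bounded by `1`. -/
lemma norm_spiralHadamard_le {F G : ℂ → ℂ} {a b A B : ℝ} (hab : a + b + 1 < 0) (hκ : 0 < κ)
    (hκ' : κ ≤ 1 / 5)
    (hF : ∀ w ∈ spiralDomain κ 1, ‖F w‖ ≤ A * ‖1 - w‖ ^ a)
    (hG : ∀ w ∈ spiralDomain κ 1, ‖G w‖ ≤ B * ‖1 - w‖ ^ b)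
    (hz : z ∈ spiralDomain (κ / 2) 1) (hz1 : 0 < ‖1 - z‖) (hz2 : ‖z‖ ≤ 2) :
    ‖spiralHadamard κ (1 - κ / 48 * ‖1 - z‖) F G z‖ ≤
      4 * (|A| * (1000 / κ) ^ |a| * (|B| * (1000 / κ) ^ |b|)) * (-(a + b + 1))⁻¹ *
        ‖1 - z‖ ^ (a + b + 1) := by
  have hpi := Real.pi_gt_three
  have hmem := mem_spiralDomain_of_half hκ hκ' hz hz1 hz2
  set r := ‖1 - z‖ with hr
  have hr3 : r ≤ 3 := (norm_sub_le _ _).trans (by rw [norm_one]; linarith)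
  have hδ : 0 < κ / 48 * r := by positivity
  have hδ' : κ / 48 * r ≤ 1 / 2 := by nlinarith
  have hρ : 0 < 1 - κ / 48 * r := by linarith
  have hρ1 : 1 - κ / 48 * r < 1 := by linarith
  set K := |A| * (1000 / κ) ^ |a| * (|B| * (1000 / κ) ^ |b|) with hK
  have hK0 : 0 ≤ K := by positivity
  have key : ∀ σ : ℝ, |σ| = 1 → ‖∫ α in (0 : ℝ)..Real.pi,
      F ((1 - κ / 48 * r : ℝ) * Complex.exp (α * (κ + σ * Complex.I))) * (κ + σ * Complex.I) *
        G (z * ((1 - κ / 48 * r : ℝ) * Complex.exp (α * (κ + σ * Complex.I)))⁻¹)‖ ≤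
      2 * K * ((-(a + b + 1))⁻¹ * r ^ (a + b + 1)) := by
    intro σ hσ
    have hint : IntervalIntegrable (fun α : ℝ => 2 * K * (r + α) ^ (a + b)) MeasureTheory.volume
        0 Real.pi := by
      apply ContinuousOn.intervalIntegrable_of_Icc (by linarith)
      refine continuousOn_const.mul (ContinuousOn.rpow_const (by fun_prop) fun α hα => Or.inl ?_)
      have := hα.1
      linarith
    refine (intervalIntegral.norm_integral_le_of_norm_le (by linarith)
      (.of_forall fun α hα => ?_) hint).trans ?_
    · have hα' : α ∈ Set.Icc 0 Real.pi := Set.Ioc_subset_Icc_self hα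
      have him : |((α : ℂ) * (κ + σ * Complex.I)).im| = α := by
        simp [abs_mul, hσ, abs_of_nonneg hα'.1]
      have hre : ((α : ℂ) * (κ + σ * Complex.I)).re = κ * α := by
        simp [mul_comm]
      obtain ⟨⟨c1, c2⟩, c3, c4⟩ := spiral_arc_comparable hκ hκ' hz hz1 hz2 hα' hre him rfl
      rw [← hr] at c1 c2 c3 c4
      have m1 := real_mul_exp_mem_spiralDomain hρ hρ1 (him.trans_le hα'.2)
        (by rw [hre, him])
      have m2 := div_real_mul_exp_mem_spiralDomain hκ.le hρ hmem (him.trans_le hα'.2)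
        (by rw [hre, him])
      set v := ((1 - κ / 48 * r : ℝ) : ℂ) * Complex.exp (α * (κ + σ * Complex.I))
      have hs : 0 < r + α := by linarith [hα'.1]
      have hC : 0 < 1000 / κ := by positivity
      have p1 : 0 < ‖1 - v‖ := pos_of_mul_pos_right (hs.trans_le c1) hC.le
      have p2 : 0 < ‖1 - z / v‖ := pos_of_mul_pos_right (hs.trans_le c3) hC.le
      have b1 : ‖F v‖ ≤ |A| * (1000 / κ) ^ |a| * (r + α) ^ a := by
        refine (hF v m1).trans ?_
        rw [mul_assoc]
        exact mul_le_mul (le_abs_self _) (rpow_le_of_comparable hC hs p1 c1 c2 a)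
          (by positivity) (abs_nonneg _)
      have b2 : ‖G (z / v)‖ ≤ |B| * (1000 / κ) ^ |b| * (r + α) ^ b := by
        refine (hG _ m2).trans ?_
        rw [mul_assoc]
        exact mul_le_mul (le_abs_self _) (rpow_le_of_comparable hC hs p2 c3 c4 b)
          (by positivity) (abs_nonneg _)
      have b3 : ‖(κ : ℂ) + σ * Complex.I‖ ≤ 2 := by
        refine (norm_add_le _ _).trans ?_
        rw [norm_mul, Complex.norm_real, Complex.norm_real, Complex.norm_I, Real.norm_eq_abs,
          Real.norm_eq_abs, hσ, abs_of_pos hκ]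
        linarith
      rw [← div_eq_mul_inv, norm_mul, norm_mul]
      calc ‖F v‖ * ‖(κ : ℂ) + σ * Complex.I‖ * ‖G (z / v)‖
          ≤ (|A| * (1000 / κ) ^ |a| * (r + α) ^ a) * 2 *
              (|B| * (1000 / κ) ^ |b| * (r + α) ^ b) := by gcongr
        _ = 2 * K * (r + α) ^ (a + b) := by rw [Real.rpow_add hs, hK]; ring
    · rw [intervalIntegral.integral_const_mul]
      gcongr
      exact integral_add_rpow_le hz1 hab (by linarith)
  rw [spiralHadamard_eq, norm_mul]
  have h2 : ‖(2 * Real.pi * Complex.I : ℂ)⁻¹‖ ≤ 1 := by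
    rw [norm_inv, norm_mul, norm_mul, Complex.norm_real, Complex.norm_I, Complex.norm_ofNat,
      Real.norm_of_nonneg (by linarith)]
    apply inv_le_one_of_one_le₀
    linarith
  refine (mul_le_mul h2 ((norm_sub_le _ _).trans
    (add_le_add (key 1 (by simp)) (key (-1) (by simp)))) (norm_nonneg _) zero_le_one).trans_eq ?_
  ring

end

/-! ### The proposition -/

theorem mainTheorem2
    (ψ₀ η : ℝ) (hψ₀ : 0 < ψ₀) (hψ₀' : ψ₀ < Real.pi / 2) (hη : 0 < η)
    (a b : ℝ) (hab : a + b + 1 < 0)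
    (f g : PowerSeries ℂ) (F G : ℂ → ℂ)
    (hf : IsDeltaRegular f F ψ₀ η) (hg : IsDeltaRegular g G ψ₀ η)
    (hF : F =O[𝓟 (deltaDomain ψ₀ η)] fun z : ℂ => ‖1 - z‖ ^ a)
    (hG : G =O[𝓟 (deltaDomain ψ₀ η)] fun z : ℂ => ‖1 - z‖ ^ b) :
    ∃ ψ₁ η₁ : ℝ, ψ₀ ≤ ψ₁ ∧ ψ₁ < Real.pi / 2 ∧ 0 < η₁ ∧ η₁ ≤ η ∧
      ∃ H : ℂ → ℂ, IsDeltaContinuation (hadamardProduct f g) H ψ₁ η₁ ∧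
        H =O[𝓟 (deltaDomain ψ₁ η₁)] fun z : ℂ => ‖1 - z‖ ^ (a + b + 1) := by
  obtain ⟨κ, hκ, hκ', hκsub⟩ := exists_spiralDomain_subset_deltaDomain hψ₀ hψ₀' hη
  -- Using `κ/2` here provides the margin between `z` and the contour needed for the bound.
  obtain ⟨ψ₁, η₁, hψ₁, hψ₁', hη₁, hη₁', hη₁1, hsub⟩ :=
    exists_deltaDomain_subset_spiralDomain (half_pos hκ) hψ₀' hη
  have hFd : DifferentiableOn ℂ F (spiralDomain κ 1) := (hf.analytic.mono hκsub).differentiableOn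
  have hGd : DifferentiableOn ℂ G (spiralDomain κ 1) := (hg.analytic.mono hκsub).differentiableOn
  obtain ⟨H, hHan, hHps, hH⟩ :=
    exists_spiralHadamard_continuation hκ.le hf.taylor hg.taylor hFd hGd
  obtain ⟨A, hA⟩ := isBigO_principal.1 hF
  obtain ⟨B, hB⟩ := isBigO_principal.1 hG
  have hA' : ∀ w ∈ spiralDomain κ 1, ‖F w‖ ≤ A * ‖1 - w‖ ^ a := fun w hw => by
    simpa [abs_of_nonneg (Real.rpow_nonneg (norm_nonneg (1 - w)) a)] using hA w (hκsub hw)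
  have hB' : ∀ w ∈ spiralDomain κ 1, ‖G w‖ ≤ B * ‖1 - w‖ ^ b := fun w hw => by
    simpa [abs_of_nonneg (Real.rpow_nonneg (norm_nonneg (1 - w)) b)] using hB w (hκsub hw)
  have hhalf : spiralDomain (κ / 2) 1 ⊆ spiralDomain κ 1 := by
    intro z hz
    refine lt_of_lt_of_le (show ‖z‖ < _ from hz) ?_
    gcongr
    linarith
  refine ⟨ψ₁, η₁, hψ₁, hψ₁', hη₁, hη₁', H, ⟨hHps, hHan.mono (hsub.trans hhalf)⟩,
    isBigO_principal.2
      ⟨4 * (|A| * (1000 / κ) ^ |a| * (|B| * (1000 / κ) ^ |b|)) * (-(a + b + 1))⁻¹,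
        fun z hz => ?_⟩⟩
  have hz2 : ‖z‖ ≤ 2 := by linarith [hz.1]
  have hz1 : 0 < ‖1 - z‖ := by
    rw [norm_pos_iff, sub_ne_zero]
    rintro rfl
    have := hz.2
    rw [sub_self, Complex.arg_zero, abs_zero] at this
    linarith
  have hr3 : ‖1 - z‖ ≤ 3 := (norm_sub_le _ _).trans (by rw [norm_one]; linarith)
  have hδ : 0 < κ / 48 * ‖1 - z‖ := by positivity
  rw [Real.norm_of_nonneg (Real.rpow_nonneg (norm_nonneg _) _),
    hH (1 - κ / 48 * ‖1 - z‖) (by nlinarith) (by linarith)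
      (mem_spiralDomain_of_half hκ hκ' (hsub hz) hz1 hz2)]
  exact norm_spiralHadamard_le hab hκ hκ' hA' hB' (hsub hz) hz1 hz2
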